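/- Throughout, a random projection $G:\mathbb{R}^m\to\mathbb{R}^d$ ($d\ge 1$) is a linear map whose matrix has i.i.d. $\mathcal{N}(0,1/d)$ entries. For a finite nonempty set $X$ of points of a Euclidean space and a nonempty $S\subseteq X$, the facility location cost is $\mathrm{cost}_X(S)=|S|+\sum_{x\in X}\min_{f\in S}\|x-f\|$; its minimum over all nonempty $S\subseteq X$ is $\mathrm{OPT}(X)$, and $S$ is optimal for $X$ if it attains the minimum. The doubling constant $\lambda_X$ is the least integer $\lambda$ such that for all $x\in X$ and $r>0$ the set $X\cap B(x,r)$ is covered by at most $\lambda$ balls of radius $r/2$ centred at points of $X$ (balls being closed), and the doubling dimension is $\log_2\lambda_X$. **Theorem.** Let $d=d(n)\ge 1$ be integers with $d(n)=o(\log n)$ as $n\to\infty$. Then there are reals $R_n\ge 1$ such that the sets $X_n=\{R_ne_1,\dots,R_ne_n\}\subset\mathbb{R}^n$ of $n$ points ($e_i$ the standard basis vectors) have doubling dimension $\Theta(\log n)$, and there are sequences $\varepsilon_n\to 0$ and $K_n\to\infty$ such that, for all sufficiently large $n$ and a random projection $G:\mathbb{R}^n\to\mathbb{R}^{d(n)}$: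 1. with probability at least $2/3$, $\mathrm{OPT}(GX_n)\le \varepsilon_n\cdot\mathrm{OPT}(X_n)$; 2. with probability at least $2/3$, every optimal set of facilities $\widetilde{\mathcal F}\subseteq GX_n$ for $GX_n$, pulled back to $\{x\in X_n: Gx\in\widetilde{\mathcal F}\}\subseteq X_n$, satisfies $\mathrm{cost}_{X_n}(\{x\in X_n: Gx\in\widetilde{\mathcal F}\})\ge K_n\cdot\mathrm{OPT}(X_n)$. -/

import Mathlib

open MeasureTheory ProbabilityTheory Filter Asymptotics
open scoped NNReal ENNReal Topology

noncomputable section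

namespace FacilityLocation

/-- `λ` is admissible for the finite point set `X` if for every `x ∈ X` and `r > 0` the part of `X`
in the ball `B(x, r)` is covered by at most `λ` balls of radius `r / 2` centred in `X`. -/
def IsDoublingBound {E : Type*} [PseudoMetricSpace E] (X : Finset E) (lam : ℕ) : Prop :=
  ∀ x ∈ X, ∀ r : ℝ, 0 < r → ∃ S : Finset E, S ⊆ X ∧ S.card ≤ lam ∧
    (X : Set E) ∩ Metric.closedBall x r ⊆ ⋃ s ∈ S, Metric.closedBall s (r / 2)

/-- The bound `|X|` is always admissible (so the infimum below is over a nonempty set). -/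
theorem isDoublingBound_card {E : Type*} [PseudoMetricSpace E] (X : Finset E) :
    IsDoublingBound X X.card := by
  intro x _ r hr
  refine ⟨X, subset_rfl, le_rfl, ?_⟩
  rintro y ⟨hy, -⟩
  exact Set.mem_iUnion₂.2 ⟨y, hy, Metric.mem_closedBall_self (by linarith)⟩

/-- The doubling constant of a finite point set: the least admissible `λ`. -/
def doublingConstant {E : Type*} [PseudoMetricSpace E] (X : Finset E) : ℕ :=
  sInf {lam : ℕ | IsDoublingBound X lam}

/-- The doubling dimension `log₂ λ_X`. -/
def doublingDimension {E : Type*} [PseudoMetricSpace E] (X : Finset E) : ℝ :=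
  Real.logb 2 (doublingConstant X)

/-- A solution of the facility location problem on `X`: a nonempty set of facilities in `X`. -/
def IsSolution {E : Type*} (X S : Finset E) : Prop :=
  S ⊆ X ∧ S.Nonempty

/-- The (uniform) facility location cost `|S| + ∑_{x ∈ X} min_{f ∈ S} dist x f`. -/
def cost {E : Type*} [PseudoMetricSpace E] (X S : Finset E) : ℝ :=
  (S.card : ℝ) + ∑ x ∈ X, Metric.infDist x (S : Set E)

/-- The optimal facility location cost of `X`. -/
def optCost {E : Type*} [PseudoMetricSpace E] (X : Finset E) : ℝ :=
  sInf (cost X '' {S | IsSolution X S})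

/-- `S` is an optimal set of facilities for `X`. -/
def IsOptimal {E : Type*} [PseudoMetricSpace E] (X S : Finset E) : Prop :=
  IsSolution X S ∧ ∀ S', IsSolution X S' → cost X S ≤ cost X S'

/-- A nonempty point set has an optimal set of facilities, and its cost is `optCost X`. -/
theorem exists_isOptimal {E : Type*} [PseudoMetricSpace E] (X : Finset E) (hX : X.Nonempty) :
    ∃ S, IsOptimal X S ∧ cost X S = optCost X := by
  have hfin : {S | IsSolution X S}.Finite :=
    (X.powerset.finite_toSet).subset fun S hS => by simpa using hS.1
  obtain ⟨S, hS, hmin⟩ := Set.exists_min_image _ (cost X) hfin ⟨X, subset_rfl, hX⟩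
  refine ⟨S, ⟨hS, hmin⟩, ?_⟩
  have h : IsLeast (cost X '' {S | IsSolution X S}) (cost X S) := by
    refine ⟨⟨S, hS, rfl⟩, ?_⟩
    rintro _ ⟨S', hS', rfl⟩
    exact hmin S' hS'
  exact h.csInf_eq.symm

/-- The law of a random projection from `ℝ^m` to `ℝ^d`: a `d × m` matrix with independent
`N(0, 1/d)` entries. -/
def randomProjection (m d : ℕ) : Measure (Fin d → Fin m → ℝ) :=
  Measure.pi fun _ : Fin d => Measure.pi fun _ : Fin m => gaussianReal 0 ((d : ℝ≥0)⁻¹)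

instance instIsProbabilityMeasureRandomProjection (m d : ℕ) :
    IsProbabilityMeasure (randomProjection m d) := by
  unfold randomProjection; infer_instance

/-- The linear map `x ↦ G x` between Euclidean spaces. -/
def proj {m d : ℕ} (G : Fin d → Fin m → ℝ) (x : EuclideanSpace ℝ (Fin m)) :
    EuclideanSpace ℝ (Fin d) :=
  WithLp.toLp 2 ((Matrix.of G).mulVec x.ofLp)

open Classical in
/-- The projected dataset `GX`. -/
def projSet {m d : ℕ} (G : Fin d → Fin m → ℝ) (X : Finset (EuclideanSpace ℝ (Fin m))) :
    Finset (EuclideanSpace ℝ (Fin d)) :=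
  X.image (proj G)

open Classical in
/-- The pullback to `X` of a set `S ⊆ GX` of facilities. -/
def pullback {m d : ℕ} (G : Fin d → Fin m → ℝ) (X : Finset (EuclideanSpace ℝ (Fin m)))
    (S : Finset (EuclideanSpace ℝ (Fin d))) : Finset (EuclideanSpace ℝ (Fin m)) :=
  X.filter fun x => proj G x ∈ S

end FacilityLocation

end

/-! With R = n^(1/(8d)), which tends to infinity because d = o(log n), the points of X are pairwise
at distance R√2 ≥ 1. Serving a point from elsewhere then never beats opening it, so OPT(X) = n.

After projection, the squared norms sum to R² times the squared Frobenius norm of G, which has mean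
n; Markov bounds the sum by 3nR² with probability at least 2/3. On that event few points lie outside
the ball of radius R³, and the rest have a 4/R-net of at most R^(4d) = √n points. Opening the
outliers and the net costs at most 8n/R (`optCost_le_of_sum_norm_sq_le`).

On the same event an optimal set for GX has at most 8n/R ≤ n/2 facilities. Almost surely G is
injective on X, so the pullback is no larger, and at least n/2 points of X each pay R√2. -/

namespace FacilityLocation

/-! ### Separated sets and nets by volume comparison -/

section Nets

open Metric Module

variable {E : Type*} [NormedAddCommGroup E] [NormedSpace ℝ E] [FiniteDimensional ℝ E]

open scoped Function in
/-- A `δ`-separated set in the ball of radius `T` has at most `(1 + 2T/δ)^dim` points. -/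
theorem card_le_of_separated (s : Finset E) {T δ : ℝ} (hT : 0 ≤ T) (hδ : 0 < δ)
    (hs : ∀ c ∈ s, ‖c‖ ≤ T) (h : ∀ c ∈ s, ∀ d ∈ s, c ≠ d → δ ≤ dist c d) :
    (s.card : ℝ) ≤ (1 + 2 * T / δ) ^ finrank ℝ E := by
  borelize E
  let μ : Measure E := Measure.addHaar
  have hρ : 0 < T + δ / 2 := by positivity
  -- Balls of radius `δ / 2` about the points are disjoint and fit in the ball of radius `T + δ /
  -- 2`; compare Haar volumes.
  have hδ2 : 0 < δ / 2 := by positivity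
  set A := ⋃ c ∈ s, ball (c : E) (δ / 2) with hA
  have D : Set.Pairwise (s : Set E) (Disjoint on fun c => ball (c : E) (δ / 2)) := by
    rintro c hc d hd hcd
    apply ball_disjoint_ball
    have := h c hc d hd hcd
    linarith
  have A_subset : A ⊆ ball (0 : E) (T + δ / 2) := by
    refine Set.iUnion₂_subset fun x hx => ?_
    apply ball_subset_ball'
    rw [dist_zero_right]
    linarith [hs x hx]
  have I : (s.card : ℝ≥0∞) * ENNReal.ofReal ((δ / 2) ^ finrank ℝ E) * μ (ball 0 1) ≤
      ENNReal.ofReal ((T + δ / 2) ^ finrank ℝ E) * μ (ball 0 1) :=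
    calc
      _ = μ A := by
        rw [hA, measure_biUnion_finset D fun c _ => measurableSet_ball]
        simp only [μ.addHaar_ball_of_pos _ hδ2]
        simp only [Finset.sum_const, nsmul_eq_mul, mul_assoc]
      _ ≤ μ (ball (0 : E) (T + δ / 2)) := measure_mono A_subset
      _ = _ := by simp only [μ.addHaar_ball_of_pos _ hρ]
  have J : (s.card : ℝ≥0∞) * ENNReal.ofReal ((δ / 2) ^ finrank ℝ E) ≤
      ENNReal.ofReal ((T + δ / 2) ^ finrank ℝ E) :=
    (ENNReal.mul_le_mul_iff_left (measure_ball_pos _ _ zero_lt_one).ne' measure_ball_lt_top.ne).1 I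
  have K := ENNReal.toReal_le_of_le_ofReal (pow_nonneg hρ.le _) J
  rw [ENNReal.toReal_mul, ENNReal.toReal_natCast, ENNReal.toReal_ofReal (by positivity)] at K
  have e : 1 + 2 * T / δ = (T + δ / 2) / (δ / 2) := by field_simp; ring
  rw [e, div_pow, le_div_iff₀ (by positivity)]
  exact K

/-- A finite set in the ball of radius `T` has a `δ`-net of at most `(1 + 2T/δ)^dim` points. -/
theorem exists_net (Q : Finset E) {T δ : ℝ} (hT : 0 ≤ T) (hδ : 0 < δ)
    (hQ : ∀ x ∈ Q, ‖x‖ ≤ T) :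
    ∃ N ⊆ Q, (∀ x ∈ Q, ∃ y ∈ N, dist x y ≤ δ) ∧
      (N.card : ℝ) ≤ (1 + 2 * T / δ) ^ finrank ℝ E := by
  classical
  -- A maximal separated subset is a net: a point far from all of it could be added.
  obtain ⟨N, hN⟩ := (Q.powerset.filter
    fun N => ∀ c ∈ N, ∀ d ∈ N, c ≠ d → δ ≤ dist c d).exists_maximal ⟨∅, by simp⟩
  have hN' := hN.prop
  simp only [Finset.mem_filter, Finset.mem_powerset] at hN'
  refine ⟨N, hN'.1, fun x hx => ?_, card_le_of_separated N hT hδ (fun c hc => hQ c (hN'.1 hc)) hN'.2⟩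
  by_contra! hfar
  have hmem : insert x N ∈ Q.powerset.filter
      fun N => ∀ c ∈ N, ∀ d ∈ N, c ≠ d → δ ≤ dist c d := by
    simp only [Finset.mem_filter, Finset.mem_powerset]
    refine ⟨Finset.insert_subset hx hN'.1, fun c hc d hd hcd => ?_⟩
    rcases Finset.mem_insert.1 hc with rfl | hc' <;> rcases Finset.mem_insert.1 hd with rfl | hd'
    · exact absurd rfl hcd
    · exact (hfar d hd').le
    · rw [dist_comm]; exact (hfar c hc').le
    · exact hN'.2 c hc' d hd' hcd
  have hxN : x ∈ N := hN.le_of_ge hmem (Finset.subset_insert x N) (Finset.mem_insert_self x N)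
  have := hfar x hxN
  rw [dist_self] at this
  linarith

end Nets

/-! ### Facility location on general and equidistant sets -/

section Cost

variable {E : Type*} [PseudoMetricSpace E]

theorem cost_nonneg (X S : Finset E) : 0 ≤ cost X S :=
  add_nonneg (Nat.cast_nonneg _) (Finset.sum_nonneg fun _ _ => Metric.infDist_nonneg)

theorem card_le_cost (X S : Finset E) : (S.card : ℝ) ≤ cost X S :=
  le_add_of_nonneg_right (Finset.sum_nonneg fun _ _ => Metric.infDist_nonneg)

theorem optCost_le {X S : Finset E} (h : IsSolution X S) : optCost X ≤ cost X S := by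
  refine csInf_le ⟨0, ?_⟩ ⟨S, h, rfl⟩
  rintro _ ⟨S', -, rfl⟩
  exact cost_nonneg X S'

theorem IsOptimal.cost_le_optCost {X S : Finset E} (h : IsOptimal X S) :
    cost X S ≤ optCost X := by
  refine le_csInf ⟨_, S, h.1, rfl⟩ ?_
  rintro _ ⟨S', hS', rfl⟩
  exact h.2 S' hS'

/-- Cost of a set of facilities within distance `δ` of all points. -/
theorem cost_le_of_cover {X S : Finset E} {δ : ℝ} (h : ∀ x ∈ X, ∃ y ∈ S, dist x y ≤ δ) :
    cost X S ≤ S.card + X.card * δ := by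
  unfold cost
  gcongr
  rw [← nsmul_eq_mul, ← Finset.sum_const]
  refine Finset.sum_le_sum fun x hx => ?_
  obtain ⟨y, hy, hxy⟩ := h x hx
  exact (Metric.infDist_le_dist_of_mem (Finset.mem_coe.2 hy)).trans hxy

theorem infDist_of_equidistant {S : Finset E} {x : E} {D : ℝ} (hS : S.Nonempty)
    (h : ∀ y ∈ S, dist x y = D) : Metric.infDist x (S : Set E) = D := by
  obtain ⟨y, hy⟩ := hS
  refine le_antisymm ?_ ?_
  · rw [← h y hy]
    exact Metric.infDist_le_dist_of_mem (Finset.mem_coe.2 hy)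
  · rw [Metric.le_infDist ⟨y, Finset.mem_coe.2 hy⟩]
    exact fun z hz => (h z (Finset.mem_coe.1 hz)).ge

theorem cost_of_equidistant {X S : Finset E} {D : ℝ} (hS : IsSolution X S)
    (h : ∀ x ∈ X, ∀ y ∈ X, x ≠ y → dist x y = D) :
    cost X S = S.card + (X.card - S.card) * D := by
  classical
  unfold cost
  have h1 : ∑ x ∈ S, Metric.infDist x (S : Set E) = 0 :=
    Finset.sum_eq_zero fun x hx => Metric.infDist_zero_of_mem (Finset.mem_coe.2 hx)
  have h2 : ∑ x ∈ X \ S, Metric.infDist x (S : Set E) = ∑ _x ∈ X \ S, D := by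
    refine Finset.sum_congr rfl fun x hx => infDist_of_equidistant hS.2 fun y hy => ?_
    rw [Finset.mem_sdiff] at hx
    exact h x hx.1 y (hS.1 hy) (by rintro rfl; exact hx.2 hy)
  rw [← Finset.sum_sdiff hS.1, h1, h2, Finset.sum_const, Finset.card_sdiff_of_subset hS.1,
    nsmul_eq_mul, Nat.cast_sub (Finset.card_le_card hS.1), add_zero]

/-- Opening one more facility costs 1 and saves `D ≥ 1`, so opening everything is optimal. -/
theorem optCost_of_equidistant {X : Finset E} {D : ℝ} (hX : X.Nonempty) (hD : 1 ≤ D)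
    (h : ∀ x ∈ X, ∀ y ∈ X, x ≠ y → dist x y = D) : optCost X = X.card := by
  refine le_antisymm ?_ ?_
  · refine (optCost_le ⟨subset_rfl, hX⟩).trans_eq ?_
    rw [cost_of_equidistant ⟨subset_rfl, hX⟩ h]
    ring
  · obtain ⟨S, hS, hc⟩ := exists_isOptimal X hX
    rw [← hc, cost_of_equidistant hS.1 h]
    have : (S.card : ℝ) ≤ X.card := Nat.cast_le.2 (Finset.card_le_card hS.1.1)
    nlinarith

theorem doublingConstant_of_equidistant {X : Finset E} {D : ℝ} (hD : 0 < D)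
    (h : ∀ x ∈ X, ∀ y ∈ X, x ≠ y → dist x y = D) : doublingConstant X = X.card := by
  refine le_antisymm (Nat.sInf_le (isDoublingBound_card X)) ?_
  refine le_csInf ⟨_, isDoublingBound_card X⟩ fun lam hlam => ?_
  rcases X.eq_empty_or_nonempty with rfl | ⟨x, hx⟩
  · simp
  -- At radius `D` the ball contains all of `X`, while each ball of radius `D / 2` centred in `X`
  -- holds only its centre.
  obtain ⟨S, hSX, hcard, hcov⟩ := hlam x hx D hD
  refine (Finset.card_le_card fun y hy => ?_).trans hcard
  have hy' : y ∈ Metric.closedBall x D := by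
    rcases eq_or_ne y x with rfl | hne
    · exact Metric.mem_closedBall_self hD.le
    · exact (h y hy x hx hne).le
  obtain ⟨s, hs, hys⟩ := Set.mem_iUnion₂.1 (hcov ⟨Finset.mem_coe.2 hy, hy'⟩)
  rcases eq_or_ne y s with rfl | hne
  · exact hs
  · rw [Metric.mem_closedBall, h y hy s (hSX hs) hne] at hys
    linarith

end Cost

/-- A point set with few points outside the ball of radius `a ^ 3` has small facility location
cost in dimension `d` with `a ^ (8 * d) = n`. -/
theorem optCost_le_of_sum_norm_sq_le {n d : ℕ} (hd : 1 ≤ d) {a : ℝ} (ha : 2 ≤ a)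
    (han : a ^ (8 * d) = n) (P : Finset (EuclideanSpace ℝ (Fin d))) (hP : P.Nonempty)
    (hcard : P.card ≤ n) (hsum : ∑ x ∈ P, ‖x‖ ^ 2 ≤ 3 * n * a ^ 2) :
    optCost P ≤ 8 / a * n := by
  classical
  have ha0 : 0 < a := by linarith
  have ha1 : 1 ≤ a := by linarith
  have hδ : 0 < 4 / a := by positivity
  set Q := P.filter fun x => ‖x‖ ≤ a ^ 3 with hQ
  set F := P.filter fun x => ¬ ‖x‖ ≤ a ^ 3 with hF
  obtain ⟨N, hNQ, hcov, hNcard⟩ := exists_net Q (T := a ^ 3) (by positivity) hδ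
    fun x hx => (Finset.mem_filter.1 hx).2
  have hcov' : ∀ x ∈ P, ∃ y ∈ F ∪ N, dist x y ≤ 4 / a := by
    intro x hx
    by_cases hxa : ‖x‖ ≤ a ^ 3
    · obtain ⟨y, hy, hxy⟩ := hcov x (Finset.mem_filter.2 ⟨hx, hxa⟩)
      exact ⟨y, Finset.mem_union_right _ hy, hxy⟩
    · exact ⟨x, Finset.mem_union_left _ (Finset.mem_filter.2 ⟨hx, hxa⟩), by
        rw [dist_self]; exact hδ.le⟩
  have hsol : IsSolution P (F ∪ N) := by
    refine ⟨Finset.union_subset (Finset.filter_subset _ _)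
      (hNQ.trans (Finset.filter_subset _ _)), ?_⟩
    obtain ⟨x, hx⟩ := hP
    obtain ⟨y, hy, -⟩ := hcov' x hx
    exact ⟨y, hy⟩
  have hn0 : (0 : ℝ) ≤ n := Nat.cast_nonneg n
  -- Chebyshev: each outlier contributes more than `a ^ 6` to the sum of squares.
  have hFcard : (F.card : ℝ) * a ^ 6 ≤ 3 * n * a ^ 2 := by
    refine le_trans ?_ hsum
    rw [← nsmul_eq_mul, ← Finset.sum_const]
    refine (Finset.sum_le_sum fun x hx => ?_).trans
      (Finset.sum_le_sum_of_subset_of_nonneg (Finset.filter_subset _ P)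
        fun x _ _ => sq_nonneg ‖x‖)
    have hx' := (Finset.mem_filter.1 hx).2
    rw [not_le] at hx'
    calc a ^ 6 = (a ^ 3) ^ 2 := by ring
      _ ≤ ‖x‖ ^ 2 := by gcongr
  have hF' : (F.card : ℝ) ≤ 3 / a * n := by
    have h1 : (F.card : ℝ) * a ^ 4 ≤ 3 * n := by
      refine le_of_mul_le_mul_right ?_ (show 0 < a ^ 2 by positivity)
      calc (F.card : ℝ) * a ^ 4 * a ^ 2 = F.card * a ^ 6 := by ring
        _ ≤ _ := hFcard
    have h2 : (F.card : ℝ) * a ≤ 3 * n := by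
      refine le_trans ?_ h1
      gcongr
      exact le_self_pow₀ ha1 (by norm_num)
    rw [div_mul_eq_mul_div, le_div_iff₀ ha0]
    exact h2
  have hN' : (N.card : ℝ) ≤ 1 / a * n := by
    have h1 : (N.card : ℝ) ≤ (a ^ 4) ^ d := by
      refine hNcard.trans ?_
      rw [finrank_euclideanSpace_fin]
      have e : 1 + 2 * a ^ 3 / (4 / a) = 1 + a ^ 4 / 2 := by field_simp; ring
      rw [e]
      have : (2 : ℝ) ≤ a ^ 4 := ha.trans (le_self_pow₀ ha1 (by norm_num))
      gcongr
      linarith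
    -- The exponent 8 leaves room for the extra factor `a`: `4 * d + 1 ≤ 8 * d` as `d ≥ 1`.
    have h2 : (a ^ 4) ^ d * a ≤ n := by
      rw [← han, ← pow_mul, ← pow_succ]
      exact pow_le_pow_right₀ ha1 (by omega)
    rw [div_mul_eq_mul_div, le_div_iff₀ ha0, one_mul]
    exact (mul_le_mul_of_nonneg_right h1 ha0.le).trans h2
  calc optCost P ≤ cost P (F ∪ N) := optCost_le hsol
    _ ≤ (F ∪ N).card + P.card * (4 / a) := cost_le_of_cover hcov'
    _ ≤ (F.card + N.card) + n * (4 / a) := by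
      gcongr
      exact_mod_cast Finset.card_union_le F N
    _ ≤ (3 / a * n + 1 / a * n) + n * (4 / a) := by gcongr
    _ = 8 / a * n := by ring

/-! ### Second moments and almost sure injectivity of Gaussian matrices -/

section RandomProjection

variable {m d : ℕ}

theorem measurePreserving_entry (k : Fin d) (i : Fin m) :
    MeasurePreserving (fun G : Fin d → Fin m → ℝ => G k i) (randomProjection m d)
      (gaussianReal 0 ((d : ℝ≥0)⁻¹)) :=
  (measurePreserving_eval (fun _ : Fin m => gaussianReal 0 ((d : ℝ≥0)⁻¹)) i).comp
    (measurePreserving_eval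
      (fun _ : Fin d => Measure.pi fun _ : Fin m => gaussianReal 0 ((d : ℝ≥0)⁻¹)) k)

theorem integral_sq_gaussianReal (v : ℝ≥0) : ∫ x, x ^ 2 ∂gaussianReal 0 v = v := by
  have h := variance_fun_id_gaussianReal (μ := 0) (v := v)
  rwa [variance_of_integral_eq_zero (X := fun x : ℝ => x) measurable_id.aemeasurable
    (integral_id_gaussianReal (μ := 0) (v := v))] at h

theorem integrable_sq_gaussianReal (v : ℝ≥0) :
    Integrable (fun x : ℝ => x ^ 2) (gaussianReal 0 v) :=
  (memLp_id_gaussianReal (μ := 0) (v := v) 2).integrable_sq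

theorem integrable_entry_sq (k : Fin d) (i : Fin m) :
    Integrable (fun G : Fin d → Fin m → ℝ => G k i ^ 2) (randomProjection m d) :=
  (measurePreserving_entry k i).integrable_comp_of_integrable (integrable_sq_gaussianReal _)

theorem integral_entry_sq (k : Fin d) (i : Fin m) :
    ∫ G : Fin d → Fin m → ℝ, G k i ^ 2 ∂randomProjection m d = (d : ℝ)⁻¹ := by
  have h := (measurePreserving_entry (m := m) k i).map_eq
  have h2 := integral_sq_gaussianReal ((d : ℝ≥0)⁻¹)
  rw [← h, integral_map (measurePreserving_entry k i).measurable.aemeasurable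
    (by fun_prop)] at h2
  simpa using h2

theorem integral_sum_sq (hd : 1 ≤ d) :
    ∫ G : Fin d → Fin m → ℝ, ∑ i, ∑ k, G k i ^ 2 ∂randomProjection m d = m := by
  rw [integral_finsetSum _ fun i _ => integrable_finsetSum _ fun k _ => integrable_entry_sq k i]
  have hd' : (d : ℝ) ≠ 0 := by positivity
  have : ∀ i : Fin m, ∫ G : Fin d → Fin m → ℝ, ∑ k, G k i ^ 2 ∂randomProjection m d = 1 := by
    intro i
    rw [integral_finsetSum _ fun k _ => integrable_entry_sq k i]
    simp [integral_entry_sq, hd']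
  simp [this]

/-- Markov's inequality for the squared Frobenius norm of a random projection. -/
theorem measure_sum_sq_le (hm : 1 ≤ m) (hd : 1 ≤ d) :
    (2 / 3 : ℝ≥0∞) ≤ randomProjection m d
      {G | ∑ i, ∑ k, G k i ^ 2 ≤ 3 * (m : ℝ)} := by
  set f : (Fin d → Fin m → ℝ) → ℝ := fun G => ∑ i, ∑ k, G k i ^ 2 with hf
  have hm0 : (0 : ℝ) < m := by positivity
  have hmeas : Measurable f := by fun_prop
  have hint : Integrable f (randomProjection m d) :=
    integrable_finsetSum _ fun i _ => integrable_finsetSum _ fun k _ => integrable_entry_sq k i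
  have hMarkov := mul_meas_ge_le_integral_of_nonneg (μ := randomProjection m d) (f := f)
    (ae_of_all _ fun G => Finset.sum_nonneg fun i _ => Finset.sum_nonneg fun k _ => sq_nonneg _)
    hint (3 * m)
  rw [hf, integral_sum_sq hd, ← hf] at hMarkov
  have hA : MeasurableSet {G | f G ≤ 3 * (m : ℝ)} := measurableSet_le hmeas measurable_const
  have hc : (randomProjection m d).real {G | f G ≤ 3 * (m : ℝ)}ᶜ ≤ 1 / 3 := by
    have hsub : {G | f G ≤ 3 * (m : ℝ)}ᶜ ⊆ {G | 3 * (m : ℝ) ≤ f G} := by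
      intro G hG
      exact (lt_of_not_ge (show ¬f G ≤ 3 * (m : ℝ) from hG)).le
    have := measureReal_mono (μ := randomProjection m d) hsub
    nlinarith
  rw [probReal_compl_eq_one_sub hA] at hc
  have h23 : (2 / 3 : ℝ≥0∞) = ENNReal.ofReal (2 / 3) := by
    rw [ENNReal.ofReal_div_of_pos (by norm_num)]; simp
  rw [h23, ENNReal.ofReal_le_iff_le_toReal (measure_ne_top _ _)]
  change _ ≤ (randomProjection m d).real {G | f G ≤ 3 * (m : ℝ)}
  linarith

/-- Two coordinates have joint law `ν.prod ν`, and by Fubini an atomless `ν` gives the diagonal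
measure zero. -/
theorem ae_pi_eval_ne_eval {ν : Measure ℝ} [IsProbabilityMeasure ν] [NullSingletonClass ν]
    {i j : Fin m} (hij : i ≠ j) : ∀ᵐ x ∂Measure.pi fun _ : Fin m => ν, x i ≠ x j := by
  have hind : IndepFun (fun x : Fin m → ℝ => x i) (fun x => x j)
      (Measure.pi fun _ : Fin m => ν) :=
    (iIndepFun_pi (μ := fun _ : Fin m => ν) (X := fun _ => id)
      fun _ => measurable_id.aemeasurable).indepFun hij
  rw [indepFun_iff_map_prod_eq_prod_map_map (measurable_pi_apply i).aemeasurable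
    (measurable_pi_apply j).aemeasurable] at hind
  have hi := (measurePreserving_eval (fun _ : Fin m => ν) i).map_eq
  have hj := (measurePreserving_eval (fun _ : Fin m => ν) j).map_eq
  change Measure.map (fun x : Fin m → ℝ => x i) _ = ν at hi
  change Measure.map (fun x : Fin m → ℝ => x j) _ = ν at hj
  rw [hi, hj] at hind
  have hdiag : MeasurableSet {p : ℝ × ℝ | p.1 = p.2} :=
    measurableSet_eq_fun measurable_fst measurable_snd
  have h0 : (ν.prod ν) {p : ℝ × ℝ | p.1 = p.2} = 0 := by
    rw [Measure.measure_prod_null hdiag]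
    refine ae_of_all _ fun x => ?_
    have : Prod.mk x ⁻¹' {p : ℝ × ℝ | p.1 = p.2} = {x} := by
      ext y; simp [eq_comm]
    change ν (Prod.mk x ⁻¹' {p : ℝ × ℝ | p.1 = p.2}) = 0
    rw [this]
    exact measure_singleton x
  rw [← hind, Measure.map_apply (by fun_prop) hdiag] at h0
  rw [ae_iff]
  simpa using h0

/-- Distinct columns of a random projection are almost surely different. -/
theorem ae_columns_injective (hd : 1 ≤ d) :
    ∀ᵐ G ∂randomProjection m d, Function.Injective fun (i : Fin m) (k : Fin d) => G k i := by
  -- Zero variance would make the Gaussian a point mass. One row with distinct entries then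
  -- suffices, hence the index 0 below.
  have hv : ((d : ℝ≥0)⁻¹) ≠ 0 := by positivity
  have : NullSingletonClass (gaussianReal 0 ((d : ℝ≥0)⁻¹)) := nullSingletonClass_gaussianReal hv
  have h : ∀ i j : Fin m, i ≠ j →
      ∀ᵐ G ∂randomProjection m d, G ⟨0, hd⟩ i ≠ G ⟨0, hd⟩ j := by
    intro i j hij
    exact (measurePreserving_eval
      (fun _ : Fin d => Measure.pi fun _ : Fin m => gaussianReal 0 ((d : ℝ≥0)⁻¹))
      ⟨0, hd⟩).quasiMeasurePreserving.ae (ae_pi_eval_ne_eval hij)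
  have h' : ∀ᵐ G ∂randomProjection m d, ∀ i j : Fin m, i ≠ j →
      G ⟨0, hd⟩ i ≠ G ⟨0, hd⟩ j := by
    simp only [ae_all_iff]
    exact h
  filter_upwards [h'] with G hG i j hij
  by_contra hne
  exact hG i j hne (congrFun hij ⟨0, hd⟩)

end RandomProjection

/-! ### The scaled simplex and its projection -/

section Simplex

open Classical in
/-- The scaled standard basis `{R e₁, …, R eₙ}`. -/
noncomputable def scaledBasis (n : ℕ) (R : ℝ) : Finset (EuclideanSpace ℝ (Fin n)) :=
  Finset.univ.image fun i : Fin n => R • EuclideanSpace.single i (1 : ℝ)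

theorem scaledBasis_injective {n : ℕ} {R : ℝ} (hR : R ≠ 0) :
    Function.Injective fun i : Fin n => R • EuclideanSpace.single i (1 : ℝ) := by
  intro i j hij
  have h := congrArg (fun v : EuclideanSpace ℝ (Fin n) => v i) hij
  by_contra hne
  simp [hne, hR] at h

theorem card_scaledBasis {n : ℕ} {R : ℝ} (hR : R ≠ 0) : (scaledBasis n R).card = n := by
  classical
  rw [scaledBasis, Finset.card_image_of_injective _ (scaledBasis_injective hR)]
  simp

theorem dist_scaledBasis {n : ℕ} {R : ℝ} (hR : 0 ≤ R) :
    ∀ x ∈ scaledBasis n R, ∀ y ∈ scaledBasis n R, x ≠ y → dist x y = R * √2 := by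
  intro x hx y hy hxy
  simp only [scaledBasis, Finset.mem_image, Finset.mem_univ, true_and] at hx hy
  obtain ⟨i, rfl⟩ := hx
  obtain ⟨j, rfl⟩ := hy
  have hij : i ≠ j := by rintro rfl; exact hxy rfl
  rw [dist_smul₀, Real.norm_of_nonneg hR]
  congr 1
  rw [dist_eq_norm, EuclideanSpace.norm_eq]
  congr 1
  rw [← Finset.add_sum_erase _ _ (Finset.mem_univ i),
    ← Finset.add_sum_erase _ _ (Finset.mem_erase.2 ⟨hij.symm, Finset.mem_univ j⟩),
    Finset.sum_eq_zero]
  · simp [hij, hij.symm]; norm_num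
  · intro k hk
    simp only [Finset.mem_erase, Finset.mem_univ, and_true] at hk
    simp [hk.1, hk.2]

theorem proj_scaled_single {n d : ℕ} (G : Fin d → Fin n → ℝ) (R : ℝ) (i : Fin n) :
    proj G (R • EuclideanSpace.single i (1 : ℝ)) = R • WithLp.toLp 2 fun k => G k i := by
  ext k
  simp [proj, Matrix.mulVec_smul]

theorem norm_sq_proj_scaled_single {n d : ℕ} (G : Fin d → Fin n → ℝ) (R : ℝ) (i : Fin n) :
    ‖proj G (R • EuclideanSpace.single i (1 : ℝ))‖ ^ 2 = R ^ 2 * ∑ k, G k i ^ 2 := by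
  rw [proj_scaled_single, norm_smul, mul_pow, EuclideanSpace.real_norm_sq_eq]
  simp

/-- Only an inequality, since columns of `G` may coincide and the image then counts them once. -/
theorem sum_norm_sq_projSet_le {n d : ℕ} (G : Fin d → Fin n → ℝ) {R : ℝ} (hR : R ≠ 0) :
    ∑ x ∈ projSet G (scaledBasis n R), ‖x‖ ^ 2 ≤ R ^ 2 * ∑ i, ∑ k, G k i ^ 2 := by
  classical
  calc ∑ x ∈ projSet G (scaledBasis n R), ‖x‖ ^ 2
      ≤ ∑ x ∈ scaledBasis n R, ‖proj G x‖ ^ 2 :=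
        Finset.sum_image_le_of_nonneg fun _ _ => sq_nonneg _
    _ = R ^ 2 * ∑ i, ∑ k, G k i ^ 2 := by
        rw [scaledBasis, Finset.sum_image fun i _ j _ h => scaledBasis_injective hR h,
          Finset.mul_sum]
        exact Finset.sum_congr rfl fun i _ => norm_sq_proj_scaled_single G R i

theorem proj_injOn_scaledBasis {n d : ℕ} {G : Fin d → Fin n → ℝ} {R : ℝ} (hR : R ≠ 0)
    (hG : Function.Injective fun (i : Fin n) (k : Fin d) => G k i) :
    Set.InjOn (proj G) (scaledBasis n R : Set (EuclideanSpace ℝ (Fin n))) := by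
  intro x hx y hy hxy
  simp only [scaledBasis, Finset.coe_image, Set.mem_image, Finset.mem_coe, Finset.mem_univ,
    true_and] at hx hy
  obtain ⟨i, rfl⟩ := hx
  obtain ⟨j, rfl⟩ := hy
  rw [proj_scaled_single, proj_scaled_single] at hxy
  have h := congrArg WithLp.ofLp (smul_right_injective _ hR hxy)
  rw [hG h]

end Simplex

/-- Pulling back a set of facilities along an injective projection preserves its size. -/
theorem card_pullback {m d : ℕ} {G : Fin d → Fin m → ℝ} {X : Finset (EuclideanSpace ℝ (Fin m))}
    (hG : Set.InjOn (proj G) (X : Set (EuclideanSpace ℝ (Fin m))))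
    {S : Finset (EuclideanSpace ℝ (Fin d))} (hS : S ⊆ projSet G X) :
    (pullback G X S).card = S.card := by
  classical
  have hinj : Set.InjOn (proj G) (pullback G X S : Set (EuclideanSpace ℝ (Fin m))) :=
    hG.mono fun x hx => (Finset.mem_filter.1 hx).1
  rw [← Finset.card_image_of_injOn hinj]
  congr 1
  ext y
  simp only [pullback, Finset.mem_image, Finset.mem_filter]
  constructor
  · rintro ⟨x, ⟨-, hx⟩, rfl⟩
    exact hx
  · intro hy
    obtain ⟨x, hx, rfl⟩ := Finset.mem_image.1 (hS hy)
    exact ⟨x, ⟨hx, hy⟩, rfl⟩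

/-- A solution using at most half of the points of an equidistant set is expensive. -/
theorem le_cost_of_card_le_half {E : Type*} [PseudoMetricSpace E] {X S : Finset E} {D : ℝ}
    (hD : 0 ≤ D) (hS : IsSolution X S) (h : ∀ x ∈ X, ∀ y ∈ X, x ≠ y → dist x y = D)
    (hcard : (S.card : ℝ) ≤ X.card / 2) : D / 2 * X.card ≤ cost X S := by
  rw [cost_of_equidistant hS h]
  have : (0 : ℝ) ≤ S.card := Nat.cast_nonneg _
  nlinarith

end FacilityLocation

/-! ### Choice of the scale and the main theorem -/

open FacilityLocation

theorem theorem6p1 (d : ℕ → ℕ) (hd_pos : ∀ n, 1 ≤ d n)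
    (hd : (fun n : ℕ => (d n : ℝ)) =o[atTop] (fun n : ℕ => Real.log (n : ℝ))) :
    ∃ (R : ℕ → ℝ) (X : (n : ℕ) → Finset (EuclideanSpace ℝ (Fin n))),
      (∀ n, 1 ≤ R n ∧
        (X n : Set (EuclideanSpace ℝ (Fin n))) =
          Set.range (fun i : Fin n => R n • EuclideanSpace.single i (1 : ℝ))) ∧
      (∀ n, (X n).card = n) ∧
      (fun n : ℕ => FacilityLocation.doublingDimension (X n)) =Θ[atTop]
        (fun n : ℕ => Real.log (n : ℝ)) ∧
      (∃ ε : ℕ → ℝ, Tendsto ε atTop (𝓝 0) ∧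
        ∀ᶠ n in atTop,
          (2 / 3 : ℝ≥0∞) ≤ FacilityLocation.randomProjection n (d n)
            {G | FacilityLocation.optCost (FacilityLocation.projSet G (X n)) ≤
              ε n * FacilityLocation.optCost (X n)}) ∧
      (∃ K : ℕ → ℝ, Tendsto K atTop atTop ∧
        ∀ᶠ n in atTop,
          (2 / 3 : ℝ≥0∞) ≤ FacilityLocation.randomProjection n (d n)
            {G | ∀ S, FacilityLocation.IsOptimal (FacilityLocation.projSet G (X n)) S →
              K n * FacilityLocation.optCost (X n) ≤
                FacilityLocation.cost (X n) (FacilityLocation.pullback G (X n) S)}) := by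
  set R : ℕ → ℝ := fun n => Real.exp (Real.log n / (8 * d n)) with hRdef
  have hR1 : ∀ n, 1 ≤ R n := fun n =>
    Real.one_le_exp (div_nonneg (Real.log_natCast_nonneg n) (by positivity))
  have hR0 : ∀ n, 0 < R n := fun n => Real.exp_pos _
  have hlog : Tendsto (fun n : ℕ => Real.log (n : ℝ)) atTop atTop :=
    Real.tendsto_log_atTop.comp tendsto_natCast_atTop_atTop
  have hRtop : Tendsto R atTop atTop := by
    refine Real.tendsto_exp_atTop.comp ?_
    refine tendsto_atTop.2 fun C => ?_
    -- With this little-o constant, `log n / (8 d) ≥ |C| + 1 ≥ C` eventually.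
    have hC : 0 < 1 / (8 * (|C| + 1)) := by positivity
    filter_upwards [hd.bound hC] with n hn
    have hdn : (0 : ℝ) < d n := Nat.cast_pos.2 (hd_pos n)
    rw [Real.norm_of_nonneg hdn.le, Real.norm_of_nonneg (Real.log_natCast_nonneg n),
      div_mul_eq_mul_div, le_div_iff₀ (by positivity), one_mul] at hn
    rw [le_div_iff₀ (by positivity)]
    nlinarith [le_abs_self C]
  have hpow : ∀ n, 1 ≤ n → R n ^ (8 * d n) = n := by
    intro n hn
    have hdn : (d n : ℝ) ≠ 0 := by have := hd_pos n; positivity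
    rw [hRdef, ← Real.exp_nat_mul]
    push_cast
    rw [mul_div_cancel₀ _ (by positivity), Real.exp_log (by positivity)]
  have hD1 : ∀ n, 1 ≤ R n * √2 := fun n =>
    one_le_mul_of_one_le_of_one_le (hR1 n) (Real.one_le_sqrt.2 (by norm_num))
  have hdist := fun n => dist_scaledBasis (n := n) (hR0 n).le
  have hcard := fun n => card_scaledBasis (n := n) (hR0 n).ne'
  have hne : ∀ n, 1 ≤ n → (scaledBasis n (R n)).Nonempty := fun n hn => by
    rw [← Finset.card_pos, hcard]; exact hn
  have hopt : ∀ n, 1 ≤ n → optCost (scaledBasis n (R n)) = n := fun n hn => by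
    rw [optCost_of_equidistant (hne n hn) (hD1 n) (hdist n), hcard]
  have hproj : ∀ n, 1 ≤ n → 2 ≤ R n → ∀ G : Fin (d n) → Fin n → ℝ,
      ∑ i, ∑ k, G k i ^ 2 ≤ 3 * (n : ℝ) →
      optCost (projSet G (scaledBasis n (R n))) ≤ 8 / R n * n := by
    intro n hn h2 G hG
    refine optCost_le_of_sum_norm_sq_le (hd_pos n) h2 (hpow n hn) _ ((hne n hn).image _) ?_ ?_
    · exact Finset.card_image_le.trans_eq (hcard n)
    · refine (sum_norm_sq_projSet_le G (hR0 n).ne').trans ?_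
      nlinarith [sq_nonneg (R n)]
  refine ⟨R, fun n => scaledBasis n (R n), fun n => ⟨hR1 n, by simp [scaledBasis]⟩, hcard, ?_,
    ⟨fun n => 8 / R n, hRtop.const_div_atTop 8, ?_⟩,
    ⟨fun n => R n / 2, hRtop.atTop_div_const (by norm_num), ?_⟩⟩
  · have h : (fun n => doublingDimension (scaledBasis n (R n))) =
        fun n : ℕ => (Real.log 2)⁻¹ * Real.log (n : ℝ) := by
      funext n
      rw [doublingDimension,
        doublingConstant_of_equidistant (zero_lt_one.trans_le (hD1 n)) (hdist n), hcard,
        Real.logb, div_eq_inv_mul]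
    rw [h, isTheta_const_mul_left (inv_ne_zero (Real.log_pos (by norm_num)).ne')]
    exact isTheta_refl _ _
  · filter_upwards [eventually_ge_atTop 1, hRtop.eventually_ge_atTop 2] with n hn h2
    refine (measure_sum_sq_le hn (hd_pos n)).trans (measure_mono fun G hG => ?_)
    change _ ≤ 8 / R n * _
    rw [hopt n hn]
    exact hproj n hn h2 G hG
  -- The threshold 16 makes `8 / R n ≤ 1 / 2`. The inclusion of events holds only off the null set
  -- where columns coincide.
  · filter_upwards [eventually_ge_atTop 1, hRtop.eventually_ge_atTop 16] with n hn h16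
    refine (measure_sum_sq_le hn (hd_pos n)).trans (measure_mono_ae ?_)
    filter_upwards [ae_columns_injective (m := n) (hd_pos n)] with G hinj hG S hS
    have hn0 : (0 : ℝ) ≤ n := Nat.cast_nonneg n
    have hS' : (S.card : ℝ) ≤ n / 2 := by
      refine (card_le_cost _ S).trans (hS.cost_le_optCost.trans
        ((hproj n hn (by linarith) G hG).trans ?_))
      have : 8 / R n ≤ 1 / 2 := by
        rw [div_le_div_iff₀ (hR0 n) (by norm_num)]; linarith
      nlinarith
    have hpc := card_pullback (proj_injOn_scaledBasis (hR0 n).ne' hinj) hS.1.1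
    have hsol : IsSolution (scaledBasis n (R n)) (pullback G (scaledBasis n (R n)) S) := by
      refine ⟨Finset.filter_subset _ _, ?_⟩
      rw [← Finset.card_pos, hpc]
      exact hS.1.2.card_pos
    have hmain := le_cost_of_card_le_half (zero_le_one.trans (hD1 n)) hsol (hdist n)
      (by rw [hpc, hcard]; exact hS')
    refine le_trans ?_ hmain
    rw [hopt n hn, hcard]
    have : R n ≤ R n * √2 := le_mul_of_one_le_right (hR0 n).le (Real.one_le_sqrt.2 (by norm_num))
    gcongr
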